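/- Let $H$ be a separable infinite-dimensional complex Hilbert space. For a positive compact operator $a$ on $H$ let $\lambda_1(a)\ge\lambda_2(a)\ge\cdots\ge 0$ be its eigenvalue sequence, that is, the eigenvalues of $a$ in decreasing order, counted with multiplicity, padded with zeros if $a$ has finite rank (so that, if $a$ does not have finite rank, all $\lambda_n(a)$ are non-zero and $\lambda_n(a)\to 0$). Let $\alpha:\{0,1,2,\dots\}\to[0,\infty)$ be a monotone increasing function with $\alpha(0)=0$ and $\alpha(1)>0$, and define the non-linear trace of Choquet type $$\varphi_\alpha(a)=\sum_{i=1}^\infty\bigl(\lambda_i(a)-\lambda_{i+1}(a)\bigr)\,\alpha(i)\in[0,\infty].$$ For a compact operator $a$ on $H$ put $|||a|||_\alpha=\varphi_\alpha(|a|)\in[0,\infty]$, where $|a|=(a^*a)^{1/2}$, and let $\mathcal C^\alpha_1(H)$ be the set of all compact operators $a$ on $H$ with $|||a|||_\alpha<\infty$. Suppose that $\alpha$ is concave in the sense that $\frac{\alpha(i+1)+\alpha(i-1)}{2}\le\alpha(i)$ for all $i\ge 1$. Then $\mathcal C^\alpha_1(H)$ is a complex linear subspace of $B(H)$, $|||\cdot|||_\alpha$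 is a norm on it, and $\mathcal C^\alpha_1(H)$ is complete with respect to this norm, i.e. it is a Banach space. Moreover $\mathcal C^\alpha_1(H)$ is a $*$-ideal of $B(H)$: it is a two-sided ideal, and $a^*\in\mathcal C^\alpha_1(H)$ whenever $a\in\mathcal C^\alpha_1(H)$. -/

import Mathlib

open scoped NNReal ENNReal InnerProductSpace

noncomputable section

namespace ChoquetTrace

variable {H : Type*} [NormedAddCommGroup H] [InnerProductSpace ℂ H]

/-- The span of all eigenvectors of `a` with a real eigenvalue `> t`. Eigenspaces being independent,
its dimension is the number of eigenvalues of `a` larger than `t`, counted with multiplicity. -/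
def spectralSpan (a : H →L[ℂ] H) (t : ℝ) : Submodule ℂ H :=
  ⨆ μ : {μ : ℝ // t < μ}, Module.End.eigenspace (a : H →ₗ[ℂ] H) ((μ : ℝ) : ℂ)

/-- The eigenvalue sequence of a positive compact operator `a`: the eigenvalues in decreasing
order, counted with multiplicity, and padded with zeros if `a` has finite rank. The indices start
at `0`, so `eigenvalueSeq a n` is the `(n + 1)`-st eigenvalue `λ_{n+1}(a)`: the least `t ≥ 0` such
that at most `n` eigenvalues, counted with multiplicity, are larger than `t`. -/
def eigenvalueSeq (a : H →L[ℂ] H) (n : ℕ) : ℝ :=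
  sInf {t : ℝ | 0 ≤ t ∧ Module.rank ℂ (spectralSpan a t) ≤ n}

/-- The non-linear trace of Choquet type
`φ_α(a) = ∑_{i ≥ 1} (λ_i(a) - λ_{i+1}(a)) α(i) ∈ [0, ∞]` of a positive compact operator `a`. -/
def choquetTrace (α : ℕ → ℝ≥0) (a : H →L[ℂ] H) : ℝ≥0∞ :=
  ∑' i : ℕ, ENNReal.ofReal (eigenvalueSeq a i - eigenvalueSeq a (i + 1)) * (α (i + 1) : ℝ≥0∞)

/-- `|||a|||_α = φ_α(|a|) ∈ [0, ∞]`, where `|a| = (a* a)^{1/2}`. -/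
def choquetENorm [CompleteSpace H] (α : ℕ → ℝ≥0) (a : H →L[ℂ] H) : ℝ≥0∞ :=
  choquetTrace α (CFC.abs a)

/-- The weighted trace class: the compact operators `a` with `φ_α(|a|) < ∞`. -/
def weightedTraceClass [CompleteSpace H] (α : ℕ → ℝ≥0) : Set (H →L[ℂ] H) :=
  {a | IsCompactOperator a ∧ choquetENorm α a < ∞}

/-- The complex vector space `E` is a Banach space with respect to the norm `N`: the function `N`
is a norm, and `E` is complete for the metric that it defines. -/
def IsBanachSpaceFor {E : Type*} [AddCommGroup E] [Module ℂ E] (N : E → ℝ) : Prop :=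
  letI : Norm E := ⟨N⟩
  ∃ core : NormedSpace.Core ℂ E,
    letI : NormedAddCommGroup E := NormedAddCommGroup.ofCore core
    CompleteSpace E

/-- The eigenvalue sequence is the usual one: if `a = ∑ₙ sₙ pₙ` with a decreasing sequence
`sₙ → 0` and mutually orthogonal one-dimensional projections `pₙ = ⟨eₙ, ·⟩ eₙ`, then
`s` is the eigenvalue sequence of `a`. -/
theorem eigenvalueSeq_eq (a : H →L[ℂ] H) (s : ℕ → ℝ) (hs : Antitone s)
    (hs0 : Filter.Tendsto s Filter.atTop (nhds 0)) (e : ℕ → H) (he : Orthonormal ℂ e)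
    (hae : ∀ x, HasSum (fun n => ((s n : ℂ) * ⟪e n, x⟫_ℂ) • e n) (a x)) :
    eigenvalueSeq a = s := by
  have hpos : ∀ n, 0 ≤ s n := fun n => hs.le_of_tendsto hs0 n
  have hcoord : ∀ x m, ⟪e m, a x⟫_ℂ = (s m : ℂ) * ⟪e m, x⟫_ℂ := by
    intro x m
    have h1 := (hae x).mapL (innerSL ℂ (e m))
    have h2 : HasSum (fun n => innerSL ℂ (e m) (((s n : ℂ) * ⟪e n, x⟫_ℂ) • e n))
        ((s m : ℂ) * ⟪e m, x⟫_ℂ) := by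
      have h3 := hasSum_single (f := fun n => innerSL ℂ (e m) (((s n : ℂ) * ⟪e n, x⟫_ℂ) • e n)) m
        (by intro n hn; simp [orthonormal_iff_ite.1 he, hn.symm])
      simpa [inner_smul_right, orthonormal_iff_ite.1 he, he.1 m] using h3
    exact h1.unique h2
  have heig : ∀ m, a (e m) = (s m : ℂ) • e m := by
    intro m
    refine (hae (e m)).unique ?_
    have h3 := hasSum_single (f := fun n => ((s n : ℂ) * ⟪e n, e m⟫_ℂ) • e n) m
        (by intro n hn; simp [orthonormal_iff_ite.1 he, hn])
    simpa [orthonormal_iff_ite.1 he, he.1 m] using h3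
  have hspan : ∀ t, 0 ≤ t →
      spectralSpan a t = Submodule.span ℂ (e '' {n | t < s n}) := by
    intro t ht
    have hfin : {n | t < s n}.Finite ∨ t = 0 := by
      rcases ht.eq_or_lt with h | h
      · exact Or.inr h.symm
      · left
        have := hs0.eventually (gt_mem_nhds h)
        obtain ⟨N, hN⟩ := Filter.eventually_atTop.1 this
        refine (Set.finite_lt_nat N).subset fun n hn => ?_
        by_contra hc
        exact absurd (hN n (not_lt.1 hc)) (not_lt.2 (le_of_lt hn))
    apply le_antisymm
    · refine iSup_le ?_
      rintro ⟨μ, hμ⟩ x hx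
      have hμ0 : 0 < μ := ht.trans_lt hμ
      have hx' : a x = (μ : ℂ) • x := Module.End.mem_eigenspace_iff.1 hx
      have hmuC : (μ : ℂ) ≠ 0 := by exact_mod_cast hμ0.ne'
      have hzero : ∀ m, s m ≠ μ → ⟪e m, x⟫_ℂ = 0 := by
        intro m hm
        have h1 := hcoord x m
        rw [hx', inner_smul_right] at h1
        have h2 : ((μ : ℂ) - s m) * ⟪e m, x⟫_ℂ = 0 := by rw [sub_mul, h1, sub_self]
        rcases mul_eq_zero.1 h2 with h | h
        · exact absurd (by exact_mod_cast (sub_eq_zero.1 h).symm) hm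
        · exact h
      have hfin2 : {n | s n = μ}.Finite := by
        obtain ⟨N, hN⟩ := Filter.eventually_atTop.1 (hs0.eventually (gt_mem_nhds hμ0))
        refine (Set.finite_lt_nat N).subset fun n hn => ?_
        by_contra hc
        exact absurd (hN n (not_lt.1 hc)) (not_lt.2 (le_of_eq (Eq.symm hn)))
      have hsum : a x = ∑ n ∈ hfin2.toFinset, ((s n : ℂ) * ⟪e n, x⟫_ℂ) • e n := by
        refine (hae x).unique (hasSum_sum_of_ne_finset_zero ?_)
        intro n hn
        rw [hzero n (by simpa using hn)]
        simp
      have hmem : a x ∈ Submodule.span ℂ (e '' {n | t < s n}) := by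
        rw [hsum]
        refine Submodule.sum_mem _ fun n hn => Submodule.smul_mem _ _ (Submodule.subset_span ?_)
        refine ⟨n, ?_, rfl⟩
        have : s n = μ := by simpa using hn
        simpa [this] using hμ
      rw [hx'] at hmem
      exact (Submodule.smul_mem_iff _ hmuC).1 hmem
    · rw [Submodule.span_le]
      rintro _ ⟨n, hn, rfl⟩
      exact (le_iSup (fun μ : {μ : ℝ // t < μ} =>
        Module.End.eigenspace (a : H →ₗ[ℂ] H) ((μ : ℝ) : ℂ)) ⟨s n, hn⟩)
        (Module.End.mem_eigenspace_iff.2 (heig n))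
  have hrank : ∀ t, 0 ≤ t → ∀ n : ℕ, Module.rank ℂ (spectralSpan a t) ≤ n ↔ s n ≤ t := by
    intro t ht n
    have hinj : Function.Injective e := he.linearIndependent.injective
    have hli : LinearIndepOn ℂ id (e '' {n | t < s n}) :=
      (he.linearIndependent.linearIndepOn {n | t < s n}).id_image
    rw [hspan t ht, rank_span_set hli]
    constructor
    · intro h
      by_contra hc
      have hsub : e '' (Set.Iic n) ⊆ e '' {n | t < s n} :=
        Set.image_mono fun m hm => (not_le.1 hc).trans_le (hs hm)
      have h1 := (Cardinal.mk_le_mk_of_subset hsub).trans h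
      have h2 := Cardinal.mk_image_eq_lift e (Set.Iic n) hinj
      have h4 := Cardinal.lift_le.{0}.2 h1
      rw [h2] at h4
      simp at h4
    · intro h
      have hsub : e '' {m | t < s m} ⊆ e '' (Set.Iio n) := by
        refine Set.image_mono fun m hm => ?_
        by_contra hc
        exact absurd ((hs (not_lt.1 hc)).trans h) (not_le.2 hm)
      refine (Cardinal.mk_le_mk_of_subset hsub).trans ?_
      have h2 := Cardinal.mk_image_le_lift (f := e) (s := Set.Iio n)
      simpa using h2
  funext n
  have hset : {t : ℝ | 0 ≤ t ∧ Module.rank ℂ (spectralSpan a t) ≤ n} = Set.Ici (s n) := by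
    ext t
    constructor
    · rintro ⟨h0, h1⟩
      exact (hrank t h0 n).1 h1
    · intro h
      exact ⟨(hpos n).trans h, (hrank t ((hpos n).trans h) n).2 h⟩
  rw [eigenvalueSeq, hset, csInf_Ici]

end ChoquetTrace

end

open scoped NNReal ENNReal InnerProductSpace

noncomputable section

namespace ChoquetTrace

variable {H : Type*} [NormedAddCommGroup H] [InnerProductSpace ℂ H]

/-! Put d_i = α(i+1) - α(i). Concavity of α makes d decreasing, and summation by parts turns the
weighted trace of |a| into ∑ d_i s_i(a), where s_i(a) are the singular values. The point is a
variational formula: this sum equals the supremum of ∑_{i<n} d_i |⟨f_i, a e_i⟩| over n and over all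
pairs of Bessel sequences e, f (`besselNorm`, `besselNorm_eq_tsum`). The singular vectors attain it;
the upper bound is a rearrangement inequality (`sum_mul_le_sum_range`), and this is where
monotonicity of d enters.

A supremum of seminorms is subadditive, homogeneous and lower semicontinuous. Bessel sequences are
stable under contractions and the formula is symmetric in e and f, which yields the *-ideal
property. Since d_0 = α(1) > 0, the weighted norm dominates a multiple of the operator norm, so a
Cauchy sequence has a compact operator-norm limit, and lower semicontinuity upgrades the
convergence. -/

/-! ### Compactness of adjoints and absolute values. -/

/-- An operator `T` with `‖T x‖ ^ 2 ≤ ‖S x‖ * ‖x‖` for a compact operator `S` is compact. -/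
theorem isCompactOperator_of_norm_apply_sq_le [CompleteSpace H] {S T : H →L[ℂ] H}
    (hS : IsCompactOperator S) (h : ∀ x, ‖T x‖ ^ 2 ≤ ‖S x‖ * ‖x‖) : IsCompactOperator T := by
  have hSb : TotallyBounded (S '' Metric.ball 0 1) := by
    obtain ⟨K, hK, hsub⟩ := hS.image_ball_subset_compact (f := (S : H →ₗ[ℂ] H)) 1
    exact hK.totallyBounded.subset hsub
  refine (isCompactOperator_iff_isCompact_closure_image_ball (T : H →ₗ[ℂ] H) one_pos).2 ?_
  refine isCompact_iff_totallyBounded_isComplete.2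
    ⟨TotallyBounded.closure ?_, isClosed_closure.isComplete⟩
  rw [Metric.totallyBounded_iff]
  intro ε hε
  -- Points of the unit ball differ by at most 2 in norm, so radius ε²/2 for `S` gives ε² for the
  -- square of the norm under `T`.
  obtain ⟨t, hts, htf, hcov⟩ := Metric.finite_approx_of_totallyBounded hSb (ε ^ 2 / 2)
    (by positivity)
  set g := Function.invFunOn S (Metric.ball 0 1) with hg
  refine ⟨(fun y => T (g y)) '' t, htf.image _, ?_⟩
  rintro _ ⟨x, hx, rfl⟩
  obtain ⟨y, hy, hxy⟩ := Set.mem_iUnion₂.1 (hcov ⟨x, hx, rfl⟩)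
  refine Set.mem_iUnion₂.2 ⟨_, ⟨y, hy, rfl⟩, ?_⟩
  have hSy : S (g y) = y := Function.invFunOn_eq (hts hy)
  have hgy : g y ∈ Metric.ball 0 1 := Function.invFunOn_mem (hts hy)
  rw [mem_ball_zero_iff] at hx hgy
  rw [Metric.mem_ball, dist_eq_norm] at hxy ⊢
  change ‖T x - T (g y)‖ < ε
  rw [← hSy, ← map_sub] at hxy
  rw [← map_sub]
  have h1 := h (x - g y)
  have h2 : ‖x - g y‖ ≤ 2 := by linarith [norm_sub_le x (g y)]
  have h3 : ‖T (x - g y)‖ ^ 2 < ε ^ 2 := by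
    nlinarith [mul_le_mul_of_nonneg_left h2 (norm_nonneg (S (x - g y)))]
  exact lt_of_pow_lt_pow_left₀ 2 hε.le h3

theorem norm_apply_sq_le_norm_star_mul_self_apply [CompleteSpace H] (a : H →L[ℂ] H) (x : H) :
    ‖a x‖ ^ 2 ≤ ‖(star a * a) x‖ * ‖x‖ := by
  rw [ContinuousLinearMap.apply_norm_sq_eq_inner_adjoint_left]
  exact (Complex.re_le_norm _).trans (norm_inner_le_norm _ _)

/-- The adjoint of a compact operator is compact. -/
theorem isCompactOperator_star [CompleteSpace H] {a : H →L[ℂ] H} (ha : IsCompactOperator a) :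
    IsCompactOperator (star a : H →L[ℂ] H) := by
  refine isCompactOperator_of_norm_apply_sq_le (S := a * star a) (ha.comp_clm (star a))
    fun x => ?_
  have h := norm_apply_sq_le_norm_star_mul_self_apply (star a) x
  rwa [star_star] at h

theorem inner_cfcAbs_apply [CompleteSpace H] (a : H →L[ℂ] H) (x y : H) :
    ⟪CFC.abs a x, CFC.abs a y⟫_ℂ = ⟪a x, a y⟫_ℂ := by
  have hsa : star (CFC.abs a) = CFC.abs a := (CFC.abs_nonneg a).isSelfAdjoint
  rw [← ContinuousLinearMap.adjoint_inner_right, ← ContinuousLinearMap.adjoint_inner_right,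
    ← ContinuousLinearMap.star_eq_adjoint, ← ContinuousLinearMap.star_eq_adjoint, hsa,
    ← mul_apply_eq_comp, ← mul_apply_eq_comp, CFC.abs_mul_abs]

theorem norm_cfcAbs_apply [CompleteSpace H] (a : H →L[ℂ] H) (x : H) :
    ‖CFC.abs a x‖ = ‖a x‖ := by
  rw [@norm_eq_sqrt_re_inner ℂ, @norm_eq_sqrt_re_inner ℂ, inner_cfcAbs_apply]

theorem isCompactOperator_cfcAbs [CompleteSpace H] {a : H →L[ℂ] H} (ha : IsCompactOperator a) :
    IsCompactOperator (CFC.abs a : H →L[ℂ] H) := by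
  refine isCompactOperator_of_norm_apply_sq_le (S := star a * a) (ha.clm_comp (star a))
    fun x => ?_
  rw [norm_cfcAbs_apply]
  exact norm_apply_sq_le_norm_star_mul_self_apply a x

/-! ### Spectral theorem for positive compact operators. -/

/-- The norm of a nonzero positive compact operator is an eigenvalue. -/
theorem exists_eigenvector_norm [CompleteSpace H] {b : H →L[ℂ] H} (hb : 0 ≤ b)
    (hc : IsCompactOperator b) (h0 : b ≠ 0) : ∃ e : H, ‖e‖ = 1 ∧ b e = (‖b‖ : ℂ) • e := by
  have : Nontrivial H := by
    by_contra hn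
    rw [not_nontrivial_iff_subsingleton] at hn
    exact h0 (Subsingleton.elim _ _)
  have h1 : ‖b‖ ∈ spectrum ℝ b := CStarAlgebra.norm_mem_spectrum_of_nonneg hb
  have h2 : (‖b‖ : ℂ) ∈ spectrum ℂ b := by
    exact (spectrum.algebraMap_mem_iff ℂ).2 h1
  have hn : (‖b‖ : ℂ) ≠ 0 := by exact_mod_cast (norm_pos_iff.2 h0).ne'
  obtain ⟨v, hv⟩ := ((IsCompactOperator.hasEigenvalue_iff_mem_spectrum hc hn).2 h2).exists_hasEigenvector
  have hv0 : (‖v‖ : ℂ) ≠ 0 := by exact_mod_cast (norm_pos_iff.2 hv.2).ne'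
  refine ⟨(‖v‖ : ℂ)⁻¹ • v, by simp [norm_smul, hv.2], ?_⟩
  rw [map_smul, smul_comm]
  congr 1
  exact hv.apply_eq_smul

/-- One step of the diagonalization: split off a top eigenvector. `F` holds the eigenvectors already
removed; requiring orthogonality to it keeps the system orthonormal even once the remainder is zero.
-/
theorem exists_deflation [CompleteSpace H] (hH : ¬ FiniteDimensional ℂ H)
    {b : H →L[ℂ] H} (hb : 0 ≤ b) (hc : IsCompactOperator b) (F : Submodule ℂ H)
    [FiniteDimensional ℂ F] (hF : ∀ x ∈ F, b x = 0) :
    ∃ e ∈ Fᗮ, ‖e‖ = 1 ∧ b e = (‖b‖ : ℂ) • e ∧ ∃ b' : H →L[ℂ] H,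
      0 ≤ b' ∧ IsCompactOperator b' ∧ ‖b'‖ ≤ ‖b‖ ∧ b' e = 0 ∧ (∀ x ∈ F, b' x = 0) ∧
      ∀ x, b' x = b x - ((‖b‖ : ℂ) * ⟪e, x⟫_ℂ) • e := by
  have hsym : ∀ x y, ⟪b x, y⟫_ℂ = ⟪x, b y⟫_ℂ := fun x y =>
    (hb.isSelfAdjoint.isSymmetric) x y
  obtain ⟨e, heF, he1, hbe⟩ : ∃ e ∈ Fᗮ, ‖e‖ = 1 ∧ b e = (‖b‖ : ℂ) • e := by
    -- For `b = 0` any unit vector of `Fᗮ` serves, and one exists because `H` is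
    -- infinite-dimensional. Otherwise the top eigenvector is orthogonal to the kernel of `b`, which
    -- contains `F`.
    by_cases h0 : b = 0
    · have hne : Fᗮ ≠ ⊥ := by
        rw [Ne, Submodule.orthogonal_eq_bot_iff]
        rintro rfl
        exact hH (Module.Finite.equiv (Submodule.topEquiv (R := ℂ) (M := H)))
      obtain ⟨v, hv, hv0⟩ := Submodule.exists_mem_ne_zero_of_ne_bot hne
      exact ⟨(‖v‖ : ℂ)⁻¹ • v, Submodule.smul_mem _ _ hv, by simp [norm_smul, hv0], by simp [h0]⟩
    · obtain ⟨e, he1, hbe⟩ := exists_eigenvector_norm hb hc h0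
      refine ⟨e, ?_, he1, hbe⟩
      intro f hf
      have hn : (‖b‖ : ℂ) ≠ 0 := by exact_mod_cast (norm_pos_iff.2 h0).ne'
      have := hsym f e
      rw [hF f hf, hbe, inner_zero_left, inner_smul_right] at this
      exact (mul_eq_zero.1 this.symm).resolve_left hn
  refine ⟨e, heF, he1, hbe, ?_⟩
  set Q : H →L[ℂ] H := (ℂ ∙ e)ᗮ.starProjection with hQ
  have hQx : ∀ x, Q x = x - ⟪e, x⟫_ℂ • e := by
    intro x
    rw [hQ, Submodule.starProjection_orthogonal_val, Submodule.starProjection_unit_singleton ℂ he1]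
  have hbQ : ∀ x, b (Q x) = b x - ((‖b‖ : ℂ) * ⟪e, x⟫_ℂ) • e := by
    intro x
    rw [hQx, map_sub, map_smul, hbe, smul_smul, mul_comm]
  -- `b` preserves the orthogonal complement of its eigenvector `e`; writing the remainder as a
  -- compression shows that it is positive.
  have heq : Q * b * Q = b * Q := by
    ext x
    simp only [mul_apply_eq_comp]
    rw [hQx]
    have : ⟪e, b (Q x)⟫_ℂ = 0 := by
      rw [← hsym, hbe, inner_smul_left, hQx, inner_sub_right, inner_smul_right,
        inner_self_eq_norm_sq_to_K, he1]
      simp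
    rw [this, zero_smul, sub_zero]
  have hQs : star Q = Q := isSelfAdjoint_starProjection _
  refine ⟨b * Q, ?_, hc.comp_clm Q, ?_, ?_, ?_, hbQ⟩
  · rw [← heq]
    have := star_left_conjugate_nonneg hb Q
    rwa [hQs] at this
  · refine (norm_mul_le _ _).trans ?_
    exact mul_le_of_le_one_right (norm_nonneg _) (Submodule.starProjection_norm_le _)
  · rw [mul_apply_eq_comp, hbQ, hbe, inner_self_eq_norm_sq_to_K, he1]
    simp
  · intro x hx
    rw [mul_apply_eq_comp, hbQ, hF x hx, Submodule.inner_left_of_mem_orthogonal hx heF]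
    simp

/-- A decreasing sequence of eigenvalues of a compact operator belonging to orthonormal
eigenvectors tends to zero. -/
theorem tendsto_zero_of_orthonormal_eigenvectors {b : H →L[ℂ] H} (hc : IsCompactOperator b)
    {e : ℕ → H} (he : Orthonormal ℂ e) {s : ℕ → ℝ} (hs : Antitone s) (hs0 : ∀ n, 0 ≤ s n)
    (hbe : ∀ n, b (e n) = (s n : ℂ) • e n) : Filter.Tendsto s Filter.atTop (nhds 0) := by
  have hbdd : BddBelow (Set.range s) := ⟨0, by rintro _ ⟨n, rfl⟩; exact hs0 n⟩
  have hlim := tendsto_atTop_ciInf hs hbdd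
  set L := ⨅ n, s n with hL
  have hL0 : 0 ≤ L := le_ciInf hs0
  rcases hL0.eq_or_lt with h | h
  · rwa [← h] at hlim
  exfalso
  obtain ⟨K, hK, hsub⟩ := hc.image_closedBall_subset_compact (f := (b : H →ₗ[ℂ] H)) 1
  obtain ⟨x, -, φ, hφ, hx⟩ := hK.tendsto_subseq (x := fun n => b (e n))
    (fun n => hsub ⟨e n, by simp [he.1 n], rfl⟩)
  obtain ⟨N, hN⟩ := Metric.cauchySeq_iff'.1 hx.cauchySeq L h
  have h1 := hN (N + 1) (Nat.le_succ N)
  have hne : φ (N + 1) ≠ φ N := (hφ (Nat.lt_succ_self N)).ne'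
  simp only [Function.comp] at h1
  -- By Pythagoras the images stay at distance at least `L`, against the Cauchy property of the
  -- subsequence.
  have h2 : ‖b (e (φ (N + 1))) - b (e (φ N))‖ ^ 2 = s (φ (N + 1)) ^ 2 + s (φ N) ^ 2 := by
    rw [@norm_sub_sq ℂ, hbe, hbe, inner_smul_left, inner_smul_right, he.2 hne, norm_smul, norm_smul,
      he.1, he.1]
    simp
  have h3 : L ≤ s (φ (N + 1)) := ciInf_le hbdd _
  rw [dist_eq_norm] at h1
  nlinarith [norm_nonneg (b (e (φ (N + 1))) - b (e (φ N))), sq_nonneg (s (φ N))]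

/-- The spectral theorem for a positive compact operator on an infinite-dimensional Hilbert
space. -/
theorem exists_spectral_expansion [CompleteSpace H] (hH : ¬ FiniteDimensional ℂ H)
    {b : H →L[ℂ] H} (hb : 0 ≤ b) (hc : IsCompactOperator b) :
    ∃ (s : ℕ → ℝ) (e : ℕ → H), Antitone s ∧ Filter.Tendsto s Filter.atTop (nhds 0) ∧
      Orthonormal ℂ e ∧ (∀ n, b (e n) = (s n : ℂ) • e n) ∧
      (∀ x, HasSum (fun n => ((s n : ℂ) * ⟪e n, x⟫_ℂ) • e n) (b x)) := by
  let State := {p : (H →L[ℂ] H) × Submodule ℂ H // 0 ≤ p.1 ∧ IsCompactOperator p.1 ∧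
    FiniteDimensional ℂ p.2 ∧ ∀ x ∈ p.2, p.1 x = 0}
  have step : ∀ p : State, ∃ (e : H) (q : State), e ∈ p.1.2ᗮ ∧ ‖e‖ = 1 ∧
      p.1.1 e = (‖p.1.1‖ : ℂ) • e ∧ ‖q.1.1‖ ≤ ‖p.1.1‖ ∧ p.1.2 ≤ q.1.2 ∧ e ∈ q.1.2 ∧
      ∀ x, q.1.1 x = p.1.1 x - ((‖p.1.1‖ : ℂ) * ⟪e, x⟫_ℂ) • e := by
    rintro ⟨⟨c, F⟩, hc0, hcc, hF, hcF⟩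
    dsimp only at hc0 hcc hF hcF
    obtain ⟨e, heF, he1, hce, c', hc0', hcc', hn, hc'e, hc'F, hc'x⟩ :=
      exists_deflation hH hc0 hcc F hcF
    refine ⟨e, ⟨⟨c', F ⊔ ℂ ∙ e⟩, hc0', hcc', ?_, ?_⟩, heF, he1, hce, hn, le_sup_left,
      Submodule.mem_sup_right (Submodule.mem_span_singleton_self e), hc'x⟩
    · exact Submodule.finiteDimensional_sup _ _
    · intro x hx
      have : F ⊔ ℂ ∙ e ≤ LinearMap.ker (c' : H →ₗ[ℂ] H) :=
        sup_le (fun y hy => hc'F y hy) ((Submodule.span_singleton_le_iff_mem _ _).2 hc'e)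
      exact this hx
  choose E nxt h1 h2 h3 h4 h5 h6 h7 using step
  let p0 : State := ⟨⟨b, ⊥⟩, hb, hc, inferInstance, by
    intro x hx
    rw [(Submodule.mem_bot ℂ).1 hx, map_zero]⟩
  let p : ℕ → State := fun n => Nat.rec p0 (fun _ q => nxt q) n
  have hp : ∀ n, p (n + 1) = nxt (p n) := fun n => rfl
  set s : ℕ → ℝ := fun n => ‖(p n).1.1‖ with hs
  set e : ℕ → H := fun n => E (p n) with he
  have hFmono : Monotone fun n => (p n).1.2 := monotone_nat_of_le_succ fun n => h5 (p n)
  have hmem : ∀ m n, m < n → e m ∈ (p n).1.2 := fun m n hmn =>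
    hFmono (Nat.succ_le_of_lt hmn) (h6 (p m))
  have horth : ∀ m n, m < n → ⟪e m, e n⟫_ℂ = 0 := fun m n hmn =>
    h1 (p n) _ (hmem m n hmn)
  have hON : Orthonormal ℂ e := by
    refine ⟨fun n => h2 _, fun m n hmn => ?_⟩
    rcases lt_or_gt_of_ne hmn with h | h
    · exact horth m n h
    · exact inner_eq_zero_symm.1 (horth n m h)
  have hanti : Antitone s := antitone_nat_of_succ_le fun n => h4 (p n)
  have hexp : ∀ n x, (p n).1.1 x = b x - ∑ i ∈ Finset.range n, ((s i : ℂ) * ⟪e i, x⟫_ℂ) • e i := by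
    intro n x
    induction n with
    | zero => simp [p, p0]
    | succ n ih =>
      rw [hp, h7, ih, Finset.sum_range_succ, sub_sub]
  have hbe : ∀ n, b (e n) = (s n : ℂ) • e n := by
    intro n
    have := hexp n (e n)
    rw [Finset.sum_eq_zero, sub_zero] at this
    · rw [← this]; exact h3 (p n)
    · intro i hi
      rw [horth i n (Finset.mem_range.1 hi)]
      simp
  have hlim : Filter.Tendsto s Filter.atTop (nhds 0) :=
    tendsto_zero_of_orthonormal_eigenvectors hc hON hanti (fun n => norm_nonneg _) hbe
  refine ⟨s, e, hanti, hlim, hON, hbe, fun x => ?_⟩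
  have hsum : Summable fun n => ((s n : ℂ) * ⟪e n, x⟫_ℂ) • e n := by
    have h8 := (hON.orthogonalFamily.summable_iff_norm_sq_summable
      (fun n => (s n : ℂ) * ⟪e n, x⟫_ℂ)).2 ?_
    · simpa using h8
    · refine Summable.of_nonneg_of_le (fun n => by positivity) (fun n => ?_)
        ((hON.inner_products_summable x).mul_left (s 0 ^ 2))
      rw [norm_mul, mul_pow, Complex.norm_real, Real.norm_eq_abs, sq_abs]
      have : s n ^ 2 ≤ s 0 ^ 2 := pow_le_pow_left₀ (norm_nonneg _) (hanti (Nat.zero_le n)) 2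
      gcongr
  refine (hsum.hasSum_iff_tendsto_nat).2 ?_
  -- The remainder after `n` steps has operator norm exactly `s n`.
  have h9 : Filter.Tendsto (fun n => (p n).1.1 x) Filter.atTop (nhds 0) := by
    refine squeeze_zero_norm (a := fun n => s n * ‖x‖) (fun n => (p n).1.1.le_opNorm x) ?_
    simpa using hlim.mul_const ‖x‖
  have h10 := (tendsto_const_nhds (x := b x)).sub h9
  rw [sub_zero] at h10
  refine h10.congr fun n => ?_
  rw [hexp n x, sub_sub_cancel]

/-! ### Bessel sequences. -/

/-- A sequence satisfying Bessel's inequality. -/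
def IsBessel (e : ℕ → H) : Prop :=
  ∀ (t : Finset ℕ) (x : H), ∑ i ∈ t, ‖⟪e i, x⟫_ℂ‖ ^ 2 ≤ ‖x‖ ^ 2

theorem _root_.Orthonormal.isBessel {e : ℕ → H} (he : Orthonormal ℂ e) : IsBessel e :=
  fun _ x => he.sum_inner_products_le x

theorem IsBessel.norm_le_one {e : ℕ → H} (he : IsBessel e) (i : ℕ) : ‖e i‖ ≤ 1 := by
  have h := he {i} (e i)
  rw [Finset.sum_singleton, inner_self_eq_norm_sq_to_K] at h
  have h1 : ‖e i‖ ^ 2 * ‖e i‖ ^ 2 ≤ ‖e i‖ ^ 2 := by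
    simpa [← sq, ← pow_mul] using h
  by_contra hc
  have h2 : 1 < ‖e i‖ ^ 2 := one_lt_pow₀ (not_le.1 hc) two_ne_zero
  nlinarith

/-- The reason to use Bessel rather than orthonormal sequences: contractions preserve them, which
later gives the ideal property. -/
theorem IsBessel.map [CompleteSpace H] {e : ℕ → H} (he : IsBessel e) {T : H →L[ℂ] H}
    (hT : ‖T‖ ≤ 1) : IsBessel fun i => T (e i) := by
  intro t x
  simp_rw [← ContinuousLinearMap.adjoint_inner_right]
  refine (he t _).trans ?_
  have h : ‖ContinuousLinearMap.adjoint T x‖ ≤ 1 * ‖x‖ :=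
    ContinuousLinearMap.le_of_opNorm_le _ (by rwa [LinearIsometryEquiv.norm_map]) x
  rw [one_mul] at h
  gcongr

theorem isBessel_single {v : H} (hv : ‖v‖ ≤ 1) : IsBessel fun i => if i = 0 then v else 0 := by
  intro t x
  have h1 : ‖⟪v, x⟫_ℂ‖ ^ 2 ≤ ‖x‖ ^ 2 := by
    have := (norm_inner_le_norm (𝕜 := ℂ) v x).trans (mul_le_of_le_one_left (norm_nonneg x) hv)
    gcongr
  calc ∑ i ∈ t, ‖⟪(if i = 0 then v else 0 : H), x⟫_ℂ‖ ^ 2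
      = ∑ i ∈ t, if i = 0 then ‖⟪v, x⟫_ℂ‖ ^ 2 else 0 :=
        Finset.sum_congr rfl fun i _ => by split_ifs <;> simp
    _ ≤ ‖x‖ ^ 2 := by
        rw [Finset.sum_ite_eq']
        split_ifs
        · exact h1
        · positivity

/-- The products of the coefficients of two vectors of the unit ball with respect to two Bessel
sequences sum to at most `1`. -/
theorem IsBessel.sum_mul_le_one {e f : ℕ → H} (he : IsBessel e) (hf : IsBessel f)
    (t : Finset ℕ) {x y : H} (hx : ‖x‖ ≤ 1) (hy : ‖y‖ ≤ 1) :
    ∑ i ∈ t, ‖⟪e i, x⟫_ℂ‖ * ‖⟪f i, y⟫_ℂ‖ ≤ 1 := by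
  have h1 : ‖x‖ ^ 2 ≤ 1 := pow_le_one₀ (norm_nonneg _) hx
  have h2 : ‖y‖ ^ 2 ≤ 1 := pow_le_one₀ (norm_nonneg _) hy
  have h3 : ∑ i ∈ t, ‖⟪e i, x⟫_ℂ‖ * ‖⟪f i, y⟫_ℂ‖ ≤
      ∑ i ∈ t, (‖⟪e i, x⟫_ℂ‖ ^ 2 / 2 + ‖⟪f i, y⟫_ℂ‖ ^ 2 / 2) := by
    gcongr with i
    nlinarith [sq_nonneg (‖⟪e i, x⟫_ℂ‖ - ‖⟪f i, y⟫_ℂ‖)]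
  rw [Finset.sum_add_distrib, ← Finset.sum_div, ← Finset.sum_div] at h3
  linarith [he t x, hf t y]

/-! ### Singular value decomposition. -/

/-- The singular value decomposition of a compact operator. -/
theorem exists_singularValue_expansion [CompleteSpace H] (hH : ¬ FiniteDimensional ℂ H)
    {a : H →L[ℂ] H} (hc : IsCompactOperator a) :
    ∃ (s : ℕ → ℝ) (u v : ℕ → H), Antitone s ∧ Filter.Tendsto s Filter.atTop (nhds 0) ∧
      eigenvalueSeq (CFC.abs a) = s ∧ IsBessel u ∧ IsBessel v ∧
      (∀ n, ⟪u n, a (v n)⟫_ℂ = s n) ∧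
      ∀ x, HasSum (fun n => ((s n : ℂ) * ⟪v n, x⟫_ℂ) • u n) (a x) := by
  obtain ⟨s, v, hs, hs0, hv, hbv, hsum⟩ := exists_spectral_expansion hH (CFC.abs_nonneg a)
    (isCompactOperator_cfcAbs hc)
  have hin : ∀ m n, ⟪a (v m), a (v n)⟫_ℂ = if m = n then (s n : ℂ) ^ 2 else 0 := by
    intro m n
    rw [← inner_cfcAbs_apply, hbv, hbv, inner_smul_left, inner_smul_right,
      orthonormal_iff_ite.1 hv]
    split_ifs with h
    · subst h
      simp [sq]
    · simp
  have hav0 : ∀ n, s n = 0 → a (v n) = 0 := by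
    intro n hn
    rw [← norm_eq_zero, ← norm_cfcAbs_apply, hbv, hn]
    simp
  have hav : ∀ n, (s n : ℂ) • ((s n : ℂ)⁻¹ • a (v n)) = a (v n) := by
    intro n
    by_cases h : s n = 0
    · rw [hav0 n h]; simp
    · rw [smul_inv_smul₀]
      exact_mod_cast h
  -- When `s n = 0` the inverse is 0 and the left singular vector vanishes; hence this family is
  -- only Bessel, being orthonormal on the indices with `s n ≠ 0`.
  refine ⟨s, fun n => (s n : ℂ)⁻¹ • a (v n), v, hs, hs0, eigenvalueSeq_eq _ s hs hs0 v hv hsum,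
    ?_, hv.isBessel, ?_, ?_⟩
  · have hu : Orthonormal ℂ fun n : {n // s n ≠ 0} => (s n : ℂ)⁻¹ • a (v n) := by
      rw [orthonormal_iff_ite]
      rintro ⟨m, hm⟩ ⟨n, hn⟩
      have hn' : (s n : ℂ) ≠ 0 := by exact_mod_cast hn
      simp only [inner_smul_left, inner_smul_right, hin, Subtype.mk.injEq]
      split_ifs with h
      · subst h
        simp only [map_inv₀, Complex.conj_ofReal]
        field_simp
      · simp
    intro t x
    have h1 := hu.sum_inner_products_le x (s := t.subtype fun n => s n ≠ 0)
    rw [Finset.sum_subtype_eq_sum_filter (f := fun n => ‖⟪(s n : ℂ)⁻¹ • a (v n), x⟫_ℂ‖ ^ 2)] at h1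
    rwa [Finset.sum_filter_of_ne] at h1
    intro n _ hn h0
    exact hn (by simp [h0])
  · intro n
    rw [inner_smul_left, hin, if_pos rfl]
    by_cases h : s n = 0
    · simp [h]
    · have hn' : (s n : ℂ) ≠ 0 := by exact_mod_cast h
      simp only [map_inv₀, Complex.conj_ofReal]
      field_simp
  · intro x
    have h1 := hsum x
    rw [HasSum, SummationFilter.unconditional_filter, tendsto_iff_norm_sub_tendsto_zero] at h1 ⊢
    refine h1.congr fun t => ?_
    -- Since |a| and a have equal norms on every vector, the expansion errors of the two operators
    -- have equal norms.
    have h2 : ∑ n ∈ t, ((s n : ℂ) * ⟪v n, x⟫_ℂ) • v n - CFC.abs a x =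
        CFC.abs a (∑ n ∈ t, ⟪v n, x⟫_ℂ • v n - x) := by
      simp only [map_sub, map_sum, map_smul, hbv, smul_smul, mul_comm]
    rw [h2, norm_cfcAbs_apply, map_sub, map_sum]
    congr 2
    refine Finset.sum_congr rfl fun n _ => ?_
    rw [map_smul, mul_comm, mul_smul, hav]

/-! ### Summation by parts and rearrangement. -/

/-- Abel summation for a decreasing null sequence. -/
theorem tsum_ofReal_mul_eq {s : ℕ → ℝ} (hs : Antitone s)
    (hs0 : Filter.Tendsto s Filter.atTop (nhds 0)) (c : ℕ → ℝ≥0∞) :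
    ∑' n, ENNReal.ofReal (s n) * c n =
      ∑' m, ENNReal.ofReal (s m - s (m + 1)) * ∑ n ∈ Finset.range (m + 1), c n := by
  have hσ : ∀ m, 0 ≤ s m - s (m + 1) := fun m => sub_nonneg.2 (hs (Nat.le_succ m))
  -- Each term is the telescoping sum of the later differences; exchanging the two nonnegative sums
  -- then gives the claim.
  have h1 : ∀ n, ENNReal.ofReal (s n) =
      ∑' m, if n ≤ m then ENNReal.ofReal (s m - s (m + 1)) else 0 := by
    intro n
    have hsum : HasSum (fun k => s (k + n) - s (k + n + 1)) (s n) := by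
      rw [hasSum_iff_tendsto_nat_of_nonneg fun k => hσ (k + n)]
      have h2 : ∀ K, ∑ k ∈ Finset.range K, (s (k + n) - s (k + n + 1)) = s n - s (K + n) := by
        intro K
        have := Finset.sum_range_sub' (fun k => s (k + n)) K
        simpa [add_right_comm] using this
      simp_rw [h2]
      have h3 := (hs0.comp (Filter.tendsto_add_atTop_nat n)).const_sub (s n)
      simpa using h3
    have h4 : ∑' m, (if n ≤ m then ENNReal.ofReal (s m - s (m + 1)) else 0) =
        ∑' k, ENNReal.ofReal (s (k + n) - s (k + n + 1)) := by
      rw [← (add_left_injective n).tsum_eq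
        (f := fun m => if n ≤ m then ENNReal.ofReal (s m - s (m + 1)) else 0)]
      · exact tsum_congr fun k => if_pos (Nat.le_add_left n k)
      · intro m hm
        have h5 : n ≤ m := by
          by_contra h
          exact hm (if_neg h)
        exact ⟨m - n, Nat.sub_add_cancel h5⟩
    rw [h4, ← ENNReal.ofReal_tsum_of_nonneg (fun k => hσ (k + n)) hsum.summable, hsum.tsum_eq]
  simp_rw [h1, ← ENNReal.tsum_mul_right]
  rw [ENNReal.tsum_comm]
  refine tsum_congr fun m => ?_
  rw [tsum_eq_sum (s := Finset.range (m + 1)), Finset.mul_sum]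
  · refine Finset.sum_congr rfl fun n hn => ?_
    rw [if_pos (Nat.lt_succ_iff.1 (Finset.mem_range.1 hn))]
  · intro n hn
    rw [if_neg, zero_mul]
    intro h
    exact hn (Finset.mem_range.2 (Nat.lt_succ_of_le h))

/-- A rearrangement inequality: the weights `C i ∈ [0, 1]` of total mass at most `M` are best
placed on the first `M` indices. -/
theorem sum_mul_le_sum_range {d : ℕ → ℝ} (hd : Antitone d) (hd0 : ∀ i, 0 ≤ d i) {C : ℕ → ℝ}
    {N M : ℕ} (hC0 : ∀ i, 0 ≤ C i) (hC1 : ∀ i, C i ≤ 1) (hC : ∑ i ∈ Finset.range N, C i ≤ M) :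
    ∑ i ∈ Finset.range N, d i * C i ≤ ∑ i ∈ Finset.range M, d i := by
  -- Threshold at `d M`: the excess above it is collected only for `i < M`, and the rest costs at
  -- most `d M * M`.
  have h1 : ∀ i, d i * C i ≤ d M * C i + if i < M then d i - d M else 0 := by
    intro i
    split_ifs with h
    · nlinarith [mul_le_mul_of_nonneg_left (hC1 i) (sub_nonneg.2 (hd h.le))]
    · nlinarith [mul_le_mul_of_nonneg_right (hd (not_lt.1 h)) (hC0 i)]
  have h2 : ∑ i ∈ Finset.range N, (if i < M then d i - d M else 0) ≤
      ∑ i ∈ Finset.range M, (d i - d M) := by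
    rw [← Finset.sum_filter]
    refine Finset.sum_le_sum_of_subset_of_nonneg (fun i hi => ?_) fun i hi _ =>
      sub_nonneg.2 (hd (Finset.mem_range.1 hi).le)
    exact Finset.mem_range.2 (Finset.mem_filter.1 hi).2
  have h3 := Finset.sum_le_sum fun i (_ : i ∈ Finset.range N) => h1 i
  rw [Finset.sum_add_distrib, ← Finset.mul_sum] at h3
  rw [Finset.sum_sub_distrib, Finset.sum_const, Finset.card_range, nsmul_eq_mul] at h2
  nlinarith [mul_le_mul_of_nonneg_left hC (hd0 M)]

/-! ### The variational formula. -/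

/-- The dual description of the weighted norm with the decreasing weights `d`. -/
def besselNorm (d : ℕ → ℝ≥0) (a : H →L[ℂ] H) : ℝ≥0∞ :=
  ⨆ (n : ℕ) (e : {e : ℕ → H // IsBessel e}) (f : {f : ℕ → H // IsBessel f}),
    ∑ i ∈ Finset.range n, (d i : ℝ≥0∞) * ‖⟪f.1 i, a (e.1 i)⟫_ℂ‖ₑ

theorem le_besselNorm (d : ℕ → ℝ≥0) (a : H →L[ℂ] H) (n : ℕ) {e f : ℕ → H} (he : IsBessel e)
    (hf : IsBessel f) :
    ∑ i ∈ Finset.range n, (d i : ℝ≥0∞) * ‖⟪f i, a (e i)⟫_ℂ‖ₑ ≤ besselNorm d a :=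
  le_iSup_of_le n (le_iSup_of_le ⟨e, he⟩ (le_iSup_of_le ⟨f, hf⟩ le_rfl))

theorem besselNorm_le {d : ℕ → ℝ≥0} {a : H →L[ℂ] H} {C : ℝ≥0∞}
    (h : ∀ (n : ℕ) (e f : ℕ → H), IsBessel e → IsBessel f →
      ∑ i ∈ Finset.range n, (d i : ℝ≥0∞) * ‖⟪f i, a (e i)⟫_ℂ‖ₑ ≤ C) : besselNorm d a ≤ C :=
  iSup_le fun n => iSup_le fun e => iSup_le fun f => h n e.1 f.1 e.2 f.2

/-- Testing on the singular vectors gives `≥`. For `≤`, Abel summation cuts `a` into layers; in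
layer `m` the matrix of products of coefficients, with columns `n ≤ m`, has row and column sums at
most 1, so its row sums are weights in [0, 1] of total mass at most `m + 1`, and rearrangement
applies. -/
theorem besselNorm_eq_tsum {d : ℕ → ℝ≥0} (hd : Antitone d) {a : H →L[ℂ] H} {s : ℕ → ℝ}
    {u v : ℕ → H} (hs : Antitone s) (hs0 : Filter.Tendsto s Filter.atTop (nhds 0))
    (hu : IsBessel u) (hv : IsBessel v) (huv : ∀ n, ⟪u n, a (v n)⟫_ℂ = s n)
    (ha : ∀ x, HasSum (fun n => ((s n : ℂ) * ⟪v n, x⟫_ℂ) • u n) (a x)) :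
    besselNorm d a = ∑' m, ENNReal.ofReal (s m - s (m + 1)) *
      ∑ n ∈ Finset.range (m + 1), (d n : ℝ≥0∞) := by
  have hpos : ∀ n, 0 ≤ s n := fun n => hs.le_of_tendsto hs0 n
  apply le_antisymm
  · refine besselNorm_le fun N e f he hf => ?_
    set c : ℕ → ℕ → ℝ := fun i n => ‖⟪v n, e i⟫_ℂ‖ * ‖⟪u n, f i⟫_ℂ‖ with hc
    have hc0 : ∀ i n, 0 ≤ c i n := fun i n => by positivity
    have h1 : ∀ i, ‖⟪f i, a (e i)⟫_ℂ‖ₑ ≤ ∑' m, ENNReal.ofReal (s m - s (m + 1)) *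
        ∑ n ∈ Finset.range (m + 1), ENNReal.ofReal (c i n) := by
      intro i
      rw [← tsum_ofReal_mul_eq hs hs0]
      have h2 := (ha (e i)).mapL (innerSL ℂ (f i))
      rw [innerSL_apply_apply] at h2
      rw [← h2.tsum_eq]
      refine (enorm_tsum_le_tsum_enorm).trans (ENNReal.tsum_le_tsum fun n => ?_)
      rw [innerSL_apply_apply, inner_smul_right, ← ofReal_norm,
        ← ENNReal.ofReal_mul (hpos n)]
      refine ENNReal.ofReal_le_ofReal (le_of_eq ?_)
      rw [norm_mul, norm_mul, Complex.norm_real, Real.norm_of_nonneg (hpos n),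
        norm_inner_symm (f i), hc, mul_assoc]
    calc ∑ i ∈ Finset.range N, (d i : ℝ≥0∞) * ‖⟪f i, a (e i)⟫_ℂ‖ₑ
        ≤ ∑ i ∈ Finset.range N, (d i : ℝ≥0∞) * ∑' m, ENNReal.ofReal (s m - s (m + 1)) *
          ∑ n ∈ Finset.range (m + 1), ENNReal.ofReal (c i n) := by
          gcongr with i; exact h1 i
      _ = ∑' m, ∑ i ∈ Finset.range N, (d i : ℝ≥0∞) * (ENNReal.ofReal (s m - s (m + 1)) *
          ∑ n ∈ Finset.range (m + 1), ENNReal.ofReal (c i n)) := by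
          simp_rw [← ENNReal.tsum_mul_left]
          rw [Summable.tsum_finsetSum fun _ _ => ENNReal.summable]
      _ ≤ _ := by
          refine ENNReal.tsum_le_tsum fun m => ?_
          simp_rw [mul_left_comm _ (ENNReal.ofReal (s m - s (m + 1)))]
          rw [← Finset.mul_sum]
          gcongr
          have h3 := sum_mul_le_sum_range (d := fun i => (d i : ℝ)) (N := N) (M := m + 1)
            (C := fun i => ∑ n ∈ Finset.range (m + 1), c i n)
            (fun i j hij => by exact_mod_cast hd hij) (fun i => (d i).2)
            (fun i => Finset.sum_nonneg fun n _ => hc0 i n)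
            (fun i => hv.sum_mul_le_one hu _ (he.norm_le_one i) (hf.norm_le_one i)) ?_
          · have h4 := ENNReal.ofReal_le_ofReal h3
            rw [ENNReal.ofReal_sum_of_nonneg, ENNReal.ofReal_sum_of_nonneg] at h4
            · simp only [ENNReal.ofReal_coe_nnreal, ENNReal.ofReal_mul (NNReal.coe_nonneg _)] at h4
              simpa only [ENNReal.ofReal_sum_of_nonneg fun n _ => hc0 _ n] using h4
            · exact fun i _ => (d i).2
            · exact fun i _ => mul_nonneg (d i).2 (Finset.sum_nonneg fun n _ => hc0 i n)
          · rw [Finset.sum_comm]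
            calc ∑ n ∈ Finset.range (m + 1), ∑ i ∈ Finset.range N, c i n
                ≤ ∑ n ∈ Finset.range (m + 1), (1 : ℝ) := by
                  gcongr with n
                  simp only [hc, norm_inner_symm (v n), norm_inner_symm (u n)]
                  exact he.sum_mul_le_one hf _ (hv.norm_le_one n) (hu.norm_le_one n)
              _ = ((m + 1 : ℕ) : ℝ) := by simp
  · rw [← tsum_ofReal_mul_eq hs hs0]
    refine ENNReal.tsum_le_of_sum_range_le fun n => ?_
    refine le_trans (le_of_eq ?_) (le_besselNorm d a n hv hu)
    refine Finset.sum_congr rfl fun i _ => ?_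
    rw [huv, mul_comm, ← ofReal_norm, Complex.norm_real, Real.norm_of_nonneg (hpos i)]

/-! ### Weights from α, and identification of the two norms. -/

/-- The increments of the weight function. -/
def increments (α : ℕ → ℝ≥0) (i : ℕ) : ℝ≥0 := α (i + 1) - α i

theorem sum_increments {α : ℕ → ℝ≥0} (hα0 : α 0 = 0) (hα : Monotone α) (n : ℕ) :
    ∑ i ∈ Finset.range n, increments α i = α n := by
  simp only [increments]
  rw [Finset.sum_range_tsub hα, hα0, tsub_zero]

theorem antitone_increments {α : ℕ → ℝ≥0} (hα : Monotone α)
    (hconc : ∀ i : ℕ, (α (i + 2) + α i) / 2 ≤ α (i + 1)) : Antitone (increments α) := by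
  refine antitone_nat_of_succ_le fun i => ?_
  have h := hconc i
  have h1 := hα (Nat.le_succ i)
  have h2 := hα (Nat.le_succ (i + 1))
  simp only [increments, ← NNReal.coe_le_coe] at *
  rw [NNReal.coe_sub (hα (Nat.le_succ i)), NNReal.coe_sub (hα (Nat.le_succ (i + 1)))]
  push_cast at h ⊢
  linarith

theorem choquetENorm_eq_besselNorm [CompleteSpace H] (hH : ¬ FiniteDimensional ℂ H)
    {α : ℕ → ℝ≥0} (hα0 : α 0 = 0) (hα : Monotone α)
    (hconc : ∀ i : ℕ, (α (i + 2) + α i) / 2 ≤ α (i + 1)) {a : H →L[ℂ] H}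
    (hc : IsCompactOperator a) : choquetENorm α a = besselNorm (increments α) a := by
  obtain ⟨s, u, v, hs, hs0, hseq, hu, hv, huv, ha⟩ := exists_singularValue_expansion hH hc
  rw [besselNorm_eq_tsum (antitone_increments hα hconc) hs hs0 hu hv huv ha, choquetENorm,
    choquetTrace, hseq]
  refine tsum_congr fun m => ?_
  rw [← sum_increments hα0 hα, ENNReal.ofNNReal_finsetSum]

/-! ### Norm, ideal and continuity properties. -/

theorem besselNorm_add_le (d : ℕ → ℝ≥0) (a b : H →L[ℂ] H) :
    besselNorm d (a + b) ≤ besselNorm d a + besselNorm d b := by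
  refine besselNorm_le fun n e f he hf => ?_
  refine le_trans ?_ (add_le_add (le_besselNorm d a n he hf) (le_besselNorm d b n he hf))
  rw [← Finset.sum_add_distrib]
  gcongr with i
  rw [← mul_add, add_apply, inner_add_right]
  gcongr
  exact enorm_add_le _ _

theorem besselNorm_zero (d : ℕ → ℝ≥0) : besselNorm d (0 : H →L[ℂ] H) = 0 := by
  refine le_antisymm (besselNorm_le fun n e f _ _ => ?_) zero_le
  simp

theorem besselNorm_smul_le (d : ℕ → ℝ≥0) (c : ℂ) (a : H →L[ℂ] H) :
    besselNorm d (c • a) ≤ ‖c‖ₑ * besselNorm d a := by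
  refine besselNorm_le fun n e f he hf => ?_
  refine le_trans (le_of_eq ?_) (mul_le_mul_right (le_besselNorm d a n he hf) _)
  rw [Finset.mul_sum]
  refine Finset.sum_congr rfl fun i _ => ?_
  rw [smul_apply, inner_smul_right, enorm_mul, mul_left_comm]

theorem besselNorm_smul (d : ℕ → ℝ≥0) (c : ℂ) (a : H →L[ℂ] H) :
    besselNorm d (c • a) = ‖c‖ₑ * besselNorm d a := by
  rcases eq_or_ne c 0 with rfl | hc
  · simp [besselNorm_zero]
  refine le_antisymm (besselNorm_smul_le d c a) ?_
  have h := besselNorm_smul_le d c⁻¹ (c • a)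
  rw [inv_smul_smul₀ hc] at h
  calc ‖c‖ₑ * besselNorm d a ≤ ‖c‖ₑ * (‖c⁻¹‖ₑ * besselNorm d (c • a)) := by gcongr
    _ = besselNorm d (c • a) := by
      rw [← mul_assoc, ← enorm_mul, mul_inv_cancel₀ hc, enorm_one, one_mul]

/-- Passing to the adjoint exchanges the roles of the two Bessel sequences. -/
theorem besselNorm_star_le [CompleteSpace H] (d : ℕ → ℝ≥0) (a : H →L[ℂ] H) :
    besselNorm d (star a) ≤ besselNorm d a := by
  refine besselNorm_le fun n e f he hf => ?_
  refine le_trans (le_of_eq ?_) (le_besselNorm d a n hf he)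
  refine Finset.sum_congr rfl fun i _ => ?_
  rw [ContinuousLinearMap.star_eq_adjoint, ContinuousLinearMap.adjoint_inner_right,
    ← ofReal_norm, ← ofReal_norm, norm_inner_symm]

theorem besselNorm_mul_le_of_norm_le_one [CompleteSpace H] (d : ℕ → ℝ≥0) (a : H →L[ℂ] H)
    {b : H →L[ℂ] H} (hb : ‖b‖ ≤ 1) : besselNorm d (a * b) ≤ besselNorm d a :=
  besselNorm_le fun n _ _ he hf => le_besselNorm d a n (he.map hb) hf

theorem besselNorm_mul_lt_top [CompleteSpace H] {d : ℕ → ℝ≥0} {a : H →L[ℂ] H}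
    (ha : besselNorm d a < ∞) (b : H →L[ℂ] H) : besselNorm d (a * b) < ∞ := by
  rcases eq_or_ne b 0 with rfl | hb
  · simp [besselNorm_zero]
  have hn : (‖b‖ : ℂ) ≠ 0 := by exact_mod_cast (norm_pos_iff.2 hb).ne'
  have h : a * b = (‖b‖ : ℂ) • (a * ((‖b‖ : ℂ)⁻¹ • b)) := by
    rw [mul_smul_comm, smul_inv_smul₀ hn]
  rw [h, besselNorm_smul]
  refine ENNReal.mul_lt_top enorm_lt_top ((besselNorm_mul_le_of_norm_le_one d a ?_).trans_lt ha)
  rw [norm_smul, norm_inv, Complex.norm_real, norm_norm, inv_mul_cancel₀ (norm_ne_zero_iff.2 hb)]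

/-- The weighted norm dominates the operator norm. -/
theorem mul_enorm_le_besselNorm (d : ℕ → ℝ≥0) (a : H →L[ℂ] H) :
    (d 0 : ℝ≥0∞) * ‖a‖ₑ ≤ besselNorm d a := by
  rcases eq_or_ne (besselNorm d a) ∞ with h | h
  · rw [h]; exact le_top
  rcases eq_or_ne (d 0) 0 with h0 | h0
  · simp [h0]
  have key : ∀ x, ‖x‖ = 1 → (d 0 : ℝ) * ‖a x‖ ≤ (besselNorm d a).toReal := by
    intro x hx
    rcases eq_or_ne (a x) 0 with hz | hz
    · simp [hz]
    -- Test on the unit vectors `x` and `a x / ‖a x‖` placed at index 0, where the weight is `d 0`.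
    have h1 := le_besselNorm d a 1 (isBessel_single hx.le)
      (isBessel_single (v := (‖a x‖ : ℂ)⁻¹ • a x) (by simp [norm_smul, hz]))
    have hn : (‖a x‖ : ℂ) ≠ 0 := by exact_mod_cast (norm_pos_iff.2 hz).ne'
    have h2 : ⟪(‖a x‖ : ℂ)⁻¹ • a x, a x⟫_ℂ = ‖a x‖ := by
      rw [inner_smul_left, inner_self_eq_norm_sq_to_K, map_inv₀, Complex.conj_ofReal]
      simp only [Complex.coe_algebraMap]
      field_simp
    simp only [Finset.range_one, Finset.sum_singleton, if_true, h2] at h1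
    have h3 := ENNReal.toReal_mono h h1
    simpa using h3
  have hd : (0 : ℝ) < d 0 := by exact_mod_cast pos_iff_ne_zero.2 h0
  have h1 : ‖a‖ ≤ (besselNorm d a).toReal / d 0 := by
    refine ContinuousLinearMap.opNorm_le_of_unit_norm (by positivity) fun x hx => ?_
    rw [le_div_iff₀ hd, mul_comm]
    exact key x hx
  rw [le_div_iff₀ hd, mul_comm] at h1
  have h2 := ENNReal.ofReal_le_ofReal h1
  rwa [ENNReal.ofReal_toReal h, ENNReal.ofReal_mul hd.le, ENNReal.ofReal_coe_nnreal,
    ofReal_norm] at h2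

/-- Lower semicontinuity of the weighted norm. -/
theorem besselNorm_le_of_tendsto {d : ℕ → ℝ≥0} {u : ℕ → H →L[ℂ] H} {a : H →L[ℂ] H} {C : ℝ≥0∞}
    (hu : Filter.Tendsto u Filter.atTop (nhds a)) (h : ∀ᶠ n in Filter.atTop, besselNorm d (u n) ≤ C) :
    besselNorm d a ≤ C := by
  refine besselNorm_le fun n e f he hf => ?_
  have hcont : Continuous fun b : H →L[ℂ] H =>
      ∑ i ∈ Finset.range n, (d i : ℝ≥0∞) * ‖⟪f i, b (e i)⟫_ℂ‖ₑ := by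
    refine continuous_finsetSum _ fun i _ => ENNReal.continuous_const_mul ENNReal.coe_ne_top |>.comp ?_
    fun_prop
  refine le_of_tendsto ((hcont.tendsto a).comp hu) ?_
  filter_upwards [h] with k hk
  exact (le_besselNorm d (u k) n he hf).trans hk

/-! ### Completeness. -/

theorem isBanachSpaceFor_of_complete {E : Type*} [AddCommGroup E] [Module ℂ E] {N : E → ℝ}
    (nonneg : ∀ x, 0 ≤ N x) (smul : ∀ (c : ℂ) x, N (c • x) = ‖c‖ * N x)
    (triangle : ∀ x y, N (x + y) ≤ N x + N y) (eq_zero : ∀ x, N x = 0 → x = 0)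
    (complete : ∀ u : ℕ → E, (∀ ε > 0, ∃ K, ∀ m ≥ K, ∀ n ≥ K, N (u m - u n) < ε) →
      ∃ x, ∀ ε > 0, ∃ K, ∀ n ≥ K, N (u n - x) < ε) : IsBanachSpaceFor N := by
  let : Norm E := ⟨N⟩
  have core : NormedSpace.Core ℂ E :=
    { norm_nonneg := nonneg
      norm_smul := smul
      norm_triangle := triangle
      norm_eq_zero_iff := fun x => ⟨eq_zero x, fun h => by
        have := smul 0 x
        rw [norm_zero, zero_mul, zero_smul] at this
        rw [h]; exact this⟩ }
  refine ⟨core, ?_⟩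
  let : NormedAddCommGroup E := NormedAddCommGroup.ofCore core
  change CompleteSpace E
  refine Metric.complete_of_cauchySeq_tendsto fun u hu => ?_
  obtain ⟨x, hx⟩ := complete u fun ε hε => by
    obtain ⟨K, hK⟩ := Metric.cauchySeq_iff.1 hu ε hε
    refine ⟨K, fun m hm n hn => ?_⟩
    have := hK m hm n hn
    rwa [dist_eq_norm] at this
  refine ⟨x, Metric.tendsto_atTop.2 fun ε hε => ?_⟩
  obtain ⟨K, hK⟩ := hx ε hε
  refine ⟨K, fun n hn => ?_⟩
  rw [dist_eq_norm]
  exact hK n hn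

/-- The compact operators of finite weighted norm. -/
def besselClass (d : ℕ → ℝ≥0) : Submodule ℂ (H →L[ℂ] H) where
  carrier := {a | IsCompactOperator a ∧ besselNorm d a < ∞}
  zero_mem' := ⟨isCompactOperator_zero, by simp [besselNorm_zero]⟩
  add_mem' := fun ha hb => ⟨ha.1.add hb.1,
    (besselNorm_add_le d _ _).trans_lt (ENNReal.add_lt_top.2 ⟨ha.2, hb.2⟩)⟩
  smul_mem' := fun c _ ha => ⟨ha.1.smul c, by
    rw [besselNorm_smul]
    exact ENNReal.mul_lt_top enorm_lt_top ha.2⟩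

theorem isBanachSpaceFor_besselClass [CompleteSpace H] {d : ℕ → ℝ≥0} (hd : d 0 ≠ 0) :
    IsBanachSpaceFor fun a : besselClass (H := H) d =>
      (besselNorm d (a : H →L[ℂ] H)).toReal := by
  have hfin : ∀ a : besselClass (H := H) d, besselNorm d (a : H →L[ℂ] H) ≠ ∞ := fun a => a.2.2.ne
  have hdpos : (0 : ℝ) < d 0 := by exact_mod_cast pos_iff_ne_zero.2 hd
  have hnorm : ∀ a : besselClass (H := H) d,
      d 0 * ‖(a : H →L[ℂ] H)‖ ≤ (besselNorm d (a : H →L[ℂ] H)).toReal := by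
    intro a
    have := ENNReal.toReal_mono (hfin a) (mul_enorm_le_besselNorm d (a : H →L[ℂ] H))
    simpa using this
  refine isBanachSpaceFor_of_complete (fun _ => ENNReal.toReal_nonneg) (fun c a => ?_)
    (fun a b => ?_) (fun a ha => ?_) (fun u hu => ?_)
  · rw [Submodule.coe_smul, besselNorm_smul, ENNReal.toReal_mul, toReal_enorm]
  · rw [← ENNReal.toReal_add (hfin a) (hfin b)]
    exact ENNReal.toReal_mono (ENNReal.add_ne_top.2 ⟨hfin a, hfin b⟩) (besselNorm_add_le d _ _)
  · have h := hnorm a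
    rw [ha] at h
    have h1 : ‖(a : H →L[ℂ] H)‖ ≤ 0 := nonpos_of_mul_nonpos_right h hdpos
    exact Subtype.ext (norm_le_zero_iff.1 h1)
  · have hcauchy : CauchySeq fun n => (u n : H →L[ℂ] H) := by
      refine Metric.cauchySeq_iff.2 fun ε hε => ?_
      obtain ⟨K, hK⟩ := hu (d 0 * ε) (mul_pos hdpos hε)
      refine ⟨K, fun m hm n hn => ?_⟩
      rw [dist_eq_norm]
      exact lt_of_mul_lt_mul_left ((hnorm (u m - u n)).trans_lt (hK m hm n hn)) hdpos.le
    obtain ⟨a, ha⟩ := cauchySeq_tendsto_of_complete hcauchy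
    have hac : IsCompactOperator a :=
      isCompactOperator_of_tendsto ha (Filter.Eventually.of_forall fun n => (u n).2.1)
    have hclose : ∀ ε > 0, ∃ K, ∀ n ≥ K, besselNorm d ((u n : H →L[ℂ] H) - a) ≤
        ENNReal.ofReal ε := by
      intro ε hε
      obtain ⟨K, hK⟩ := hu ε hε
      -- With `n` fixed and `m → ∞`, lower semicontinuity carries the Cauchy bound on `u n - u m`
      -- over to `u n - a`.
      refine ⟨K, fun n hn => besselNorm_le_of_tendsto (ha.const_sub (u n : H →L[ℂ] H)) ?_⟩
      filter_upwards [Filter.eventually_ge_atTop K] with m hm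
      exact ENNReal.le_ofReal_iff_toReal_le (hfin (u n - u m)) hε.le |>.2 (hK n hn m hm).le
    have haf : besselNorm d a < ∞ := by
      obtain ⟨K, hK⟩ := hclose 1 one_pos
      have h1 : a = (u K : H →L[ℂ] H) + (-1 : ℂ) • ((u K : H →L[ℂ] H) - a) := by
        rw [neg_one_smul]; abel
      rw [h1]
      refine (besselNorm_add_le d _ _).trans_lt (ENNReal.add_lt_top.2 ⟨(u K).2.2, ?_⟩)
      rw [besselNorm_smul]
      exact ENNReal.mul_lt_top enorm_lt_top ((hK K le_rfl).trans_lt ENNReal.ofReal_lt_top)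
    refine ⟨⟨a, hac, haf⟩, fun ε hε => ?_⟩
    obtain ⟨K, hK⟩ := hclose (ε / 2) (half_pos hε)
    refine ⟨K, fun n hn => ?_⟩
    have h1 := ENNReal.toReal_mono ENNReal.ofReal_ne_top (hK n hn)
    rw [ENNReal.toReal_ofReal (half_pos hε).le] at h1
    exact h1.trans_lt (half_lt_self hε)

end ChoquetTrace

end

/-! ### The main theorem. -/

theorem mainTheorem3 {H : Type*} [NormedAddCommGroup H] [InnerProductSpace ℂ H] [CompleteSpace H]
    [TopologicalSpace.SeparableSpace H] (hH : ¬ FiniteDimensional ℂ H)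
    (α : ℕ → NNReal) (hα0 : α 0 = 0) (hα : Monotone α) (hα1 : 0 < α 1)
    (hconc : ∀ i : ℕ, (α (i + 2) + α i) / 2 ≤ α (i + 1)) :
    ∃ S : Submodule ℂ (H →L[ℂ] H),
      (S : Set (H →L[ℂ] H)) = ChoquetTrace.weightedTraceClass α ∧
      ChoquetTrace.IsBanachSpaceFor
        (fun a : S => (ChoquetTrace.choquetENorm α (a : H →L[ℂ] H)).toReal) ∧
      (∀ a ∈ S, ∀ b : H →L[ℂ] H, a * b ∈ S ∧ b * a ∈ S) ∧
      (∀ a ∈ S, star a ∈ S) := by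
  open ChoquetTrace in
  have hS : {a : H →L[ℂ] H | IsCompactOperator a ∧ besselNorm (increments α) a < ∞} =
      weightedTraceClass α := by
    ext a
    exact and_congr_right fun hc => by rw [choquetENorm_eq_besselNorm hH hα0 hα hconc hc]
  have hd : ChoquetTrace.increments α 0 ≠ 0 := by
    simpa [ChoquetTrace.increments, hα0] using hα1.ne'
  have hstar : ∀ a ∈ ChoquetTrace.besselClass (H := H) (ChoquetTrace.increments α),
      star a ∈ ChoquetTrace.besselClass (H := H) (ChoquetTrace.increments α) := fun a ha =>
    ⟨ChoquetTrace.isCompactOperator_star ha.1,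
      (ChoquetTrace.besselNorm_star_le _ a).trans_lt ha.2⟩
  have hmul : ∀ a ∈ ChoquetTrace.besselClass (H := H) (ChoquetTrace.increments α),
      ∀ b : H →L[ℂ] H, a * b ∈ ChoquetTrace.besselClass (ChoquetTrace.increments α) :=
    fun a ha b => ⟨ha.1.comp_clm b, ChoquetTrace.besselNorm_mul_lt_top ha.2 b⟩
  refine ⟨ChoquetTrace.besselClass (ChoquetTrace.increments α), hS, ?_,
    fun a ha b => ⟨hmul a ha b, ?_⟩, hstar⟩
  · convert ChoquetTrace.isBanachSpaceFor_besselClass (H := H) hd using 3 with a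
    exact ChoquetTrace.choquetENorm_eq_besselNorm hH hα0 hα hconc a.2.1
  -- Left multiplication reduces to right multiplication through b a = (a* b*)*.
  · simpa using hstar _ (hmul _ (hstar a ha) (star b))
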